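/- Let $G$ be a group and $\Bbbk$ a field. A Hopf $G$-coalgebra over $\Bbbk$ is a family $H=(H_\alpha)_{\alpha\in G}$ of unital associative $\Bbbk$-algebras with algebra homomorphisms $\Delta_{\alpha,\beta}:H_{\alpha\beta}\to H_\alpha\otimes H_\beta$ and $\varepsilon:H_1\to\Bbbk$ that are coassociative and counital, and linear maps $S_\alpha:H_\alpha\to H_{\alpha^{-1}}$ with $m_\alpha(S_{\alpha^{-1}}\otimes \mathrm{Id})\Delta_{\alpha^{-1},\alpha}=\varepsilon 1_\alpha=m_\alpha(\mathrm{Id}\otimes S_{\alpha^{-1}})\Delta_{\alpha,\alpha^{-1}}$. It is of finite type if every $H_\alpha$ is finite dimensional, and unimodular if the left and right cointegrals of $H_1$ (the $\Lambda\in H_1$ with $x\Lambda=\varepsilon(x)\Lambda$, resp. $\Lambda x=\varepsilon(x)\Lambda$, for all $x \in H_1$) coincide. A pivot is a family $g=(g_\alpha)$ of invertible elements $g_\alpha\in H_\alpha$ with $\Delta_{\alpha,\beta}(g_{\alpha\beta})=g_\alpha\otimes g_\beta$, $\varepsilon(g_1)=1$ and $S_{\alpha^{-1}}S_\alpha(x)=g_\alpha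 xg_\alpha^{-1}$. A right (resp. left) $G$-integral is a family of linear forms $\mu_\alpha\in H_\alpha^*$ with $(\mu_\alpha\otimes \mathrm{Id})\Delta_{\alpha,\beta}(x)=\mu_{\alpha\beta}(x)1_\beta$ (resp. $\mu^l_\alpha \in H_\alpha^*$ with $(\mathrm{Id}\otimes\mu^l_\beta)\Delta_{\alpha,\beta}(x)=\mu^l_{\alpha\beta}(x)1_\alpha$) for all $x\in H_{\alpha\beta}$; its symmetrised form is $\widetilde\mu_\alpha(x)=\mu_\alpha(g_\alpha x)$ (resp. $\widetilde\mu^l_\alpha(x)=\mu^l_\alpha(g_\alpha^{-1}x)$). $H_\alpha$-mod denotes the category of finite dimensional left $H_\alpha$-modules. For $V\in H_\alpha$-mod with basis $(v_j)$ and dual basis $(v^j)$ of $V^*$, the right and left categorical traces of $f\in\operatorname{End}_{H_\alpha}(V)$ are the scalars obtained as the composites $$\operatorname{tr}^{\mathcal C}_V(f):\ 1\mapsto\sum_j v_j\otimes v^j\mapsto\sum_j f(v_j)\otimes v^j\mapsto\sum_j v^j(g_\alpha f(v_j)),$$ $${}^{\mathcal C}\!\operatorname{tr}_V(f):\ 1\mapsto\sum_j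 v^j\otimes g_\alpha^{-1}v_j\mapsto\sum_j v^j\otimes f(g_\alpha^{-1}v_j)\mapsto\sum_j v^j(f(g_\alpha^{-1}v_j)).$$ Proposition. Let $(H,g)$ be a finite type unimodular pivotal Hopf $G$-coalgebra over $\Bbbk$. (1) For every $\alpha\in G$ with $H_\alpha\neq 0$, the linear form $\operatorname{tr}^{\mathcal C}_{H_\alpha}$ on $\operatorname{End}_{H_\alpha}(H_\alpha)$ (with $H_\alpha$ the left regular module) is non-zero if and only if $H$ is semisimple, that is, $H_\beta$-mod is semisimple for all $\beta\in G$; and likewise ${}^{\mathcal C}\!\operatorname{tr}_{H_\alpha}$ is non-zero if and only if $H_\beta$-mod is semisimple for all $\beta\in G$. Moreover, $H_\beta$-mod is semisimple for all $\beta\in G$ if and only if $H_1$-mod is semisimple. (2) If $H_\beta$-mod is semisimple for all $\beta\in G$, then non-zero right and left $G$-integrals exist, and for every non-zero right $G$-integral $\mu$ and every non-zero left $G$-integral $\mu^l$ there are scalars $c,c'\in\Bbbk\setminus\{0\}$ such that for all $\alpha\in G$ and all $f\in\operatorname{End}_{H_\alpha}(H_\alpha)$ $$\operatorname{tr}^{\mathcal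 C}_{H_\alpha}(f)=c\,\widetilde\mu_\alpha(f(1_\alpha)),\qquad {}^{\mathcal C}\!\operatorname{tr}_{H_\alpha}(f)=c'\,\widetilde\mu^l_\alpha(f(1_\alpha)).$$ -/

import Mathlib

open scoped TensorProduct

universe u v w

noncomputable section

/-- A Hopf `G`-coalgebra over the field `k` with underlying family of (associative, unital)
`k`-algebras `(H α)_{α ∈ G}`. The transports `AlgEquiv.cast` only identify the algebras attached to
equal elements of `G`, such as `(α * β) * γ` and `α * (β * γ)`. -/
structure HopfGCoalgebra (k : Type u) {G : Type w} (H : G → Type v) [Field k] [Group G]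
    [∀ α, Ring (H α)] [∀ α, Algebra k (H α)] where
  /-- The coproduct `Δ_{α,β} : H_{αβ} → H_α ⊗ H_β`, an algebra homomorphism. -/
  comul : ∀ α β : G, H (α * β) →ₐ[k] H α ⊗[k] H β
  /-- The counit `ε : H_1 → k`, an algebra homomorphism. -/
  counit : H 1 →ₐ[k] k
  /-- The antipode `S_α : H_α → H_{α⁻¹}`, a linear map. -/
  antipode : ∀ α : G, H α →ₗ[k] H α⁻¹
  /-- `(Δ_{α,β} ⊗ id) Δ_{αβ,γ} = (id ⊗ Δ_{β,γ}) Δ_{α,βγ}`. -/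
  coassoc : ∀ (α β γ : G) (x : H (α * β * γ)),
    TensorProduct.assoc k (H α) (H β) (H γ)
        ((comul α β).toLinearMap.rTensor (H γ) (comul (α * β) γ x)) =
      (comul β γ).toLinearMap.lTensor (H α)
        (comul α (β * γ) (AlgEquiv.cast (R := k) (A := H) (mul_assoc α β γ) x))
  /-- `(id ⊗ ε) Δ_{α,1} = id`. -/
  lTensor_counit_comul : ∀ (α : G) (x : H (α * 1)),
    TensorProduct.rid k (H α) (counit.toLinearMap.lTensor (H α) (comul α 1 x)) =
      AlgEquiv.cast (R := k) (A := H) (mul_one α) x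
  /-- `(ε ⊗ id) Δ_{1,α} = id`. -/
  rTensor_counit_comul : ∀ (α : G) (x : H (1 * α)),
    TensorProduct.lid k (H α) (counit.toLinearMap.rTensor (H α) (comul 1 α x)) =
      AlgEquiv.cast (R := k) (A := H) (one_mul α) x
  /-- `m_α (S_{α⁻¹} ⊗ id) Δ_{α⁻¹,α} = ε 1_α`. -/
  mul_antipode_rTensor_comul : ∀ (α : G) (x : H (α⁻¹ * α)),
    LinearMap.mul' k (H α)
        (((AlgEquiv.cast (R := k) (A := H) (inv_inv α)).toLinearMap ∘ₗ antipode α⁻¹).rTensor (H α)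
          (comul α⁻¹ α x)) =
      counit (AlgEquiv.cast (R := k) (A := H) (inv_mul_cancel α) x) • (1 : H α)
  /-- `m_α (id ⊗ S_{α⁻¹}) Δ_{α,α⁻¹} = ε 1_α`. -/
  mul_antipode_lTensor_comul : ∀ (α : G) (x : H (α * α⁻¹)),
    LinearMap.mul' k (H α)
        (((AlgEquiv.cast (R := k) (A := H) (inv_inv α)).toLinearMap ∘ₗ antipode α⁻¹).lTensor (H α)
          (comul α α⁻¹ x)) =
      counit (AlgEquiv.cast (R := k) (A := H) (mul_inv_cancel α) x) • (1 : H α)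

/-- The category `A`-mod of modules over the `k`-algebra `A` that are finite dimensional over `k` is
semisimple: each of its objects is a semisimple module. -/
def IsSemisimpleMod (k : Type u) (A : Type v) [Field k] [Ring A] [Algebra k A] : Prop :=
  ∀ (V : Type v) [AddCommGroup V] [Module k V] [Module A V] [IsScalarTower k A V]
    [FiniteDimensional k V], IsSemisimpleModule A V

namespace HopfGCoalgebra

variable {k : Type u} {G : Type w} {H : G → Type v} [Field k] [Group G]
  [∀ α, Ring (H α)] [∀ α, Algebra k (H α)]

/-- `Λ ∈ H_1` is a left cointegral: `x Λ = ε(x) Λ` for all `x ∈ H_1`. -/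
def IsLeftCointegral (C : HopfGCoalgebra k H) (Λ : H 1) : Prop :=
  ∀ x : H 1, x * Λ = C.counit x • Λ

/-- `Λ ∈ H_1` is a right cointegral: `Λ x = ε(x) Λ` for all `x ∈ H_1`. -/
def IsRightCointegral (C : HopfGCoalgebra k H) (Λ : H 1) : Prop :=
  ∀ x : H 1, Λ * x = C.counit x • Λ

/-- Unimodularity: the left and the right cointegrals of the Hopf algebra `H_1` coincide. -/
def IsUnimodular (C : HopfGCoalgebra k H) : Prop :=
  ∀ Λ : H 1, C.IsLeftCointegral Λ ↔ C.IsRightCointegral Λ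

/-- `(μ_α ⊗ id) Δ_{α,β}(x) = μ_{αβ}(x) 1_β` for all `x ∈ H_{αβ}`. -/
def IsRightIntegral (C : HopfGCoalgebra k H) (μ : ∀ α, Module.Dual k (H α)) : Prop :=
  ∀ (α β : G) (x : H (α * β)),
    TensorProduct.lid k (H β) ((μ α).rTensor (H β) (C.comul α β x)) = μ (α * β) x • (1 : H β)

/-- `(id ⊗ μ_β) Δ_{α,β}(x) = μ_{αβ}(x) 1_α` for all `x ∈ H_{αβ}`. -/
def IsLeftIntegral (C : HopfGCoalgebra k H) (μ : ∀ α, Module.Dual k (H α)) : Prop :=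
  ∀ (α β : G) (x : H (α * β)),
    TensorProduct.rid k (H α) ((μ β).lTensor (H α) (C.comul α β x)) = μ (α * β) x • (1 : H α)

/-- A pivot: a `G`-grouplike family `g = (g_α)` of (automatically invertible) elements with
`S_{α⁻¹} S_α (x) = g_α x g_α⁻¹`. -/
structure Pivot (C : HopfGCoalgebra k H) where
  /-- The family `(g_α)`; an element of `(H α)ˣ` is an invertible element with its inverse. -/
  toFun : ∀ α : G, (H α)ˣ
  comul_apply : ∀ α β : G,
    C.comul α β (toFun (α * β) : H (α * β)) = (toFun α : H α) ⊗ₜ[k] (toFun β : H β)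
  counit_apply : C.counit (toFun 1 : H 1) = 1
  antipode_antipode : ∀ (α : G) (x : H α),
    AlgEquiv.cast (R := k) (A := H) (inv_inv α) (C.antipode α⁻¹ (C.antipode α x)) =
      (toFun α : H α) * x * ((toFun α)⁻¹ : (H α)ˣ)

namespace Pivot

variable {C : HopfGCoalgebra k H} (g : C.Pivot)

/-- The symmetrised form `x ↦ μ_α(g_α x)` of a right `G`-integral `μ`. -/
def symRight (μ : ∀ α, Module.Dual k (H α)) (α : G) : Module.Dual k (H α) :=
  μ α ∘ₗ LinearMap.mulLeft k (g.toFun α : H α)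

/-- The symmetrised form `x ↦ μ_α(g_α⁻¹ x)` of a left `G`-integral `μ`. -/
def symLeft (μ : ∀ α, Module.Dual k (H α)) (α : G) : Module.Dual k (H α) :=
  μ α ∘ₗ LinearMap.mulLeft k (((g.toFun α)⁻¹ : (H α)ˣ) : H α)

section Duality

variable (α : G) (V : Type v) [AddCommGroup V] [Module k V] [Module (H α) V]
  [IsScalarTower k (H α) V]

/-- The evaluation `V ⊗ V^* → k`, `v ⊗ f ↦ f(g_α v)`, of an object `V` of `H_α`-mod. The evaluation
`V^* ⊗ V → k`, `f ⊗ v ↦ f(v)`, is Mathlib's `contractLeft`. -/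
def evLeft : V ⊗[k] Module.Dual k V →ₗ[k] k :=
  contractRight k V ∘ₗ
    (Algebra.lsmul k k V (g.toFun α : H α)).rTensor (Module.Dual k V)

/-- The coevaluation `k → V^* ⊗ V`, `1 ↦ ∑ v^i ⊗ g_α⁻¹ v_i`, of an object `V` of `H_α`-mod. The
coevaluation `k → V ⊗ V^*`, `1 ↦ ∑ v_j ⊗ v^j`, is Mathlib's `coevaluation`. -/
def coevLeft [FiniteDimensional k V] : k →ₗ[k] Module.Dual k V ⊗[k] V :=
  (Algebra.lsmul k k V (((g.toFun α)⁻¹ : (H α)ˣ) : H α)).lTensor (Module.Dual k V) ∘ₗ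
    (TensorProduct.comm k V (Module.Dual k V)).toLinearMap ∘ₗ coevaluation k V

variable [FiniteDimensional k V]

/-- The right categorical trace on `End_{H_α}(V)`: the scalar by which
`k → V ⊗ V^* → V ⊗ V^* → k` (coevaluation, `f ⊗ id`, evaluation with the pivot) acts. -/
def rightTrace (f : Module.End (H α) V) : k :=
  (g.evLeft α V ∘ₗ (f.restrictScalars k).rTensor (Module.Dual k V) ∘ₗ coevaluation k V) 1

/-- The left categorical trace on `End_{H_α}(V)`: the scalar by which
`k → V^* ⊗ V → V^* ⊗ V → k` (coevaluation with the pivot, `id ⊗ f`, evaluation) acts. -/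
def leftTrace (f : Module.End (H α) V) : k :=
  (contractLeft k V ∘ₗ (f.restrictScalars k).lTensor (Module.Dual k V) ∘ₗ g.coevLeft α V) 1

end Duality

end Pivot

end HopfGCoalgebra

end

/-!
Write `t_α(h) = Tr(v ↦ g_α v h)` for the trace form on `H_α`. An `H_α`-linear endomorphism `f` of
the regular module is right multiplication by `f(1)`, so its right categorical trace is `t_α(f(1))`.
Two facts about `t` carry the proof, and both come from the cyclicity of the trace combined with
the antipode axioms.

* Every value `t_α(h)` is `ε(Λ)` for some left cointegral `Λ` of `H_1`
  (`Pivot.exists_cointegral_counit_eq_regTrace`): `Λ` is the partial trace over `H_α` of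
  `v ↦ (1 ⊗ g_α) Δ_{1,α}(v h)`.
* The family `x ↦ t_α(g_α⁻¹ x)` is a right integral, whose value at a left cointegral `Λ` is `ε(Λ)`
  (`Pivot.isRightIntegral_traceIntegral`, `Pivot.traceIntegral_cointegral`).

If `t_α ≠ 0`, the first fact and unimodularity give a two-sided cointegral `Λ` with `ε(Λ) = 1`.
The components of `Δ_{α,α⁻¹}(Λ)` then form a separability idempotent of every `H_α`, and all the
`H_α` are semisimple by averaging (`Pivot.isSemisimpleMod_of_cointegral`). Conversely, if `H_1` is
semisimple, a complement of `ker ε` contains such a `Λ`. The identity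
`Δ(Λ)(y ⊗ 1) = Δ(Λ)(1 ⊗ S(y))` shows that a right integral which does not vanish at `Λ` is non-zero
on each `H_α ≠ 0`, and that every right integral is determined by its value at `Λ`
(`IsRightIntegral.eq_zero_of_apply_cointegral`). Since the integral attached to `t` is `1` at `Λ`,
it spans the right integrals, and `t` is non-zero wherever it can be.

The assertions on the left follow by applying those on the right to the co-opposite Hopf coalgebra,
which is indexed by `Gᵐᵒᵖ`, has the inverse antipode `y ↦ g⁻¹ S(y) g`, and has pivot `g⁻¹`
(`Pivot.coop`, `Pivot.coopPivot`). The antipode is bijective because its square is inner.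
-/

namespace HopfGCoalgebra

variable {k : Type u} {G : Type w} {H : G → Type v} [Field k] [Group G]
  [∀ α, Ring (H α)] [∀ α, Algebra k (H α)]

/-! ### Structure maps with free indices -/

/-- The coproduct `H_γ → H_α ⊗ H_β` attached to an equation `αβ = γ`. Keeping the index `γ` free
absorbs the transports that appear in the axioms of a Hopf `G`-coalgebra. -/
noncomputable def comulOf (C : HopfGCoalgebra k H) {α β γ : G} (h : α * β = γ) :
    H γ →ₐ[k] H α ⊗[k] H β :=
  (C.comul α β).comp (AlgEquiv.cast (R := k) (A := H) h.symm : H γ →ₐ[k] H (α * β))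

/-- The antipode `H_α → H_β` attached to an equation `αβ = 1`. -/
def antipodeOf (C : HopfGCoalgebra k H) {α β : G} (h : α * β = 1) : H α →ₗ[k] H β :=
  (AlgEquiv.cast (R := k) (A := H) (inv_eq_of_mul_eq_one_right h)).toLinearMap ∘ₗ C.antipode α

theorem comulOf_rfl (C : HopfGCoalgebra k H) (α β : G) (x : H (α * β)) :
    C.comulOf rfl x = C.comul α β x := rfl

theorem comulOf_coassoc (C : HopfGCoalgebra k H) {α β γ δ η ζ : G} (h₁ : α * β = δ)
    (h₂ : δ * γ = ζ) (h₃ : β * γ = η) (h₄ : α * η = ζ) (x : H ζ) :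
    TensorProduct.assoc k (H α) (H β) (H γ)
        ((C.comulOf h₁).toLinearMap.rTensor (H γ) (C.comulOf h₂ x)) =
      (C.comulOf h₃).toLinearMap.lTensor (H α) (C.comulOf h₄ x) := by
  subst h₁ h₂ h₃
  exact C.coassoc α β γ x

theorem lTensor_counit_comulOf (C : HopfGCoalgebra k H) {α : G} (h : α * 1 = α) (x : H α) :
    TensorProduct.rid k (H α) (C.counit.toLinearMap.lTensor (H α) (C.comulOf h x)) = x := by
  refine (C.lTensor_counit_comul α (AlgEquiv.cast (R := k) (A := H) h.symm x)).trans ?_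
  exact (AlgEquiv.cast (R := k) (A := H) h).apply_symm_apply x

theorem rTensor_counit_comulOf (C : HopfGCoalgebra k H) {α : G} (h : 1 * α = α) (x : H α) :
    TensorProduct.lid k (H α) (C.counit.toLinearMap.rTensor (H α) (C.comulOf h x)) = x := by
  refine (C.rTensor_counit_comul α (AlgEquiv.cast (R := k) (A := H) h.symm x)).trans ?_
  exact (AlgEquiv.cast (R := k) (A := H) h).apply_symm_apply x

theorem mul_antipodeOf_rTensor (C : HopfGCoalgebra k H) {α β : G} (h : α * β = 1) (x : H 1) :
    LinearMap.mul' k (H β) ((C.antipodeOf h).rTensor (H β) (C.comulOf h x)) =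
      C.counit x • (1 : H β) := by
  obtain rfl := eq_inv_of_mul_eq_one_left h
  refine (C.mul_antipode_rTensor_comul β (AlgEquiv.cast (R := k) (A := H) h.symm x)).trans ?_
  congr 2
  exact (AlgEquiv.cast (R := k) (A := H) h).apply_symm_apply x

theorem mul_antipodeOf_lTensor (C : HopfGCoalgebra k H) {α β : G} (h : α * β = 1)
    (h' : β * α = 1) (x : H 1) :
    LinearMap.mul' k (H α) ((C.antipodeOf h').lTensor (H α) (C.comulOf h x)) =
      C.counit x • (1 : H α) := by
  obtain rfl := eq_inv_of_mul_eq_one_right h |>.symm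
  refine (C.mul_antipode_lTensor_comul α (AlgEquiv.cast (R := k) (A := H) h.symm x)).trans ?_
  congr 2
  exact (AlgEquiv.cast (R := k) (A := H) h).apply_symm_apply x

theorem Pivot.comulOf_apply {C : HopfGCoalgebra k H} (g : C.Pivot) {α β γ : G} (h : α * β = γ) :
    C.comulOf h (g.toFun γ : H γ) = (g.toFun α : H α) ⊗ₜ[k] (g.toFun β : H β) := by
  subst h
  exact g.comul_apply α β

theorem Pivot.antipodeOf_antipodeOf {C : HopfGCoalgebra k H} (g : C.Pivot) {α β : G}
    (h : α * β = 1) (h' : β * α = 1) (x : H α) :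
    C.antipodeOf h' (C.antipodeOf h x) =
      (g.toFun α : H α) * x * ((g.toFun α)⁻¹ : (H α)ˣ) := by
  obtain rfl := eq_inv_of_mul_eq_one_right h |>.symm
  exact g.antipode_antipode α x

theorem IsRightIntegral.comulOf {C : HopfGCoalgebra k H} {μ : ∀ α, Module.Dual k (H α)}
    (hμ : C.IsRightIntegral μ) {α β γ : G} (h : α * β = γ) (x : H γ) :
    TensorProduct.lid k (H β) ((μ α).rTensor (H β) (C.comulOf h x)) = μ γ x • (1 : H β) := by
  subst h
  exact hμ α β x

/-! ### Contracting a coproduct against the antipode -/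

/-- If `f(Δ_{β,γ}(w)) = ε(w) m` on `H_1`, then
`(id ⊗ f) (Δ_{α,β} ⊗ id) Δ_{αβ,γ}(y) = y ⊗ m`. -/
theorem lTensor_comulOf_comulOf (C : HopfGCoalgebra k H) {α β γ δ : G} (h₁ : α * β = δ)
    (h₂ : δ * γ = α) (h₃ : β * γ = 1) {M : Type*} [AddCommGroup M] [Module k M]
    (f : H β ⊗[k] H γ →ₗ[k] M) (m : M) (hf : ∀ w : H 1, f (C.comulOf h₃ w) = C.counit w • m)
    (y : H α) :
    f.lTensor (H α) (TensorProduct.assoc k (H α) (H β) (H γ)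
      ((C.comulOf h₁).toLinearMap.rTensor (H γ) (C.comulOf h₂ y))) = y ⊗ₜ[k] m := by
  have hcomp : f ∘ₗ (C.comulOf h₃).toLinearMap =
      LinearMap.toSpanSingleton k M m ∘ₗ C.counit.toLinearMap := by
    ext w
    simpa using hf w
  have hsm : ∀ z : H α ⊗[k] k, (LinearMap.toSpanSingleton k M m).lTensor (H α) z =
      TensorProduct.rid k (H α) z ⊗ₜ[k] m := by
    intro z
    induction z with
    | zero => simp
    | add a b ha hb => simp [ha, hb, TensorProduct.add_tmul]
    | tmul a b => simp [TensorProduct.smul_tmul]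
  rw [C.comulOf_coassoc h₁ h₂ h₃ (mul_one α), ← LinearMap.comp_apply, ← LinearMap.lTensor_comp,
    hcomp, LinearMap.lTensor_comp, LinearMap.comp_apply, hsm, C.lTensor_counit_comulOf]

/-- The contraction `x ↦ ∑ p(x₂) x₁` of the coproduct. -/
noncomputable def contractOf (C : HopfGCoalgebra k H) {α β γ : G}
    (h : α * β = γ) (p : Module.Dual k (H β)) : H γ →ₗ[k] H α :=
  (TensorProduct.rid k (H α)).toLinearMap ∘ₗ p.lTensor (H α) ∘ₗ (C.comulOf h).toLinearMap

theorem contractOf_apply (C : HopfGCoalgebra k H) {α β γ : G}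
    (h : α * β = γ) (p : Module.Dual k (H β)) (x : H γ) :
    C.contractOf h p x = TensorProduct.rid k (H α) (p.lTensor (H α) (C.comulOf h x)) := rfl

theorem antipodeOf_one (C : HopfGCoalgebra k H) {α β : G} (h : α * β = 1) :
    C.antipodeOf h 1 = 1 := by
  simpa [Algebra.TensorProduct.one_def] using C.mul_antipodeOf_rTensor h 1

/-- `∑ c₁ ⊗ c₂ S(d) = y ⊗ 1`, where `Δ(y) = ∑ c ⊗ d`. -/
theorem sum_comulOf_mul_antipodeOf (C : HopfGCoalgebra k H) {α β γ δ : G} (h₁ : α * β = δ)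
    (h₂ : δ * γ = α) (h₃ : β * γ = 1) (h₄ : γ * β = 1) (y : H α) (s : Finset (H δ × H γ))
    (hs : C.comulOf h₂ y = ∑ i ∈ s, i.1 ⊗ₜ[k] i.2) :
    ∑ i ∈ s, C.comulOf h₁ i.1 * (1 ⊗ₜ[k] C.antipodeOf h₄ i.2) = y ⊗ₜ[k] (1 : H β) := by
  rw [← C.lTensor_comulOf_comulOf h₁ h₂ h₃
    (LinearMap.mul' k (H β) ∘ₗ (C.antipodeOf h₄).lTensor (H β)) 1
    (C.mul_antipodeOf_lTensor h₃ h₄) y, hs]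
  simp only [map_sum, LinearMap.rTensor_tmul]
  refine Finset.sum_congr rfl fun i _ => ?_
  generalize (i.2) = d
  have (T : H α ⊗[k] H β) : T * (1 ⊗ₜ[k] C.antipodeOf h₄ d) =
      (LinearMap.mul' k (H β) ∘ₗ (C.antipodeOf h₄).lTensor (H β)).lTensor (H α)
        (TensorProduct.assoc k (H α) (H β) (H γ) (T ⊗ₜ[k] d)) := by
    induction T with
    | zero => simp
    | add a b ha hb => rw [add_mul, ha, hb]; simp only [TensorProduct.add_tmul, map_add]
    | tmul a b => simp
  exact this _

/-- The antipode is an anti-homomorphism: both sides are obtained from `xy ⊗ 1` by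
`a ⊗ b ↦ S(a)b`, writing `x ⊗ 1` and `y ⊗ 1` as combinations of elements `Δ(c)(1 ⊗ S(d))`. -/
theorem antipodeOf_mul (C : HopfGCoalgebra k H) {α β : G} (h : α * β = 1) (x y : H α) :
    C.antipodeOf h (x * y) = C.antipodeOf h y * C.antipodeOf h x := by
  have h' : β * α = 1 := mul_eq_one_comm.mp h
  obtain ⟨s, hs⟩ := TensorProduct.exists_finset (C.comulOf (one_mul α) x)
  obtain ⟨t, ht⟩ := TensorProduct.exists_finset (C.comulOf (one_mul α) y)
  have hx := C.sum_comulOf_mul_antipodeOf h (one_mul α) h' h x s hs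
  have hy := C.sum_comulOf_mul_antipodeOf h (one_mul α) h' h y t ht
  let ψ : H α ⊗[k] H β →ₗ[k] H β := LinearMap.mul' k (H β) ∘ₗ (C.antipodeOf h).rTensor (H β)
  have hψmul (T : H α ⊗[k] H β) (z : H β) : ψ (T * 1 ⊗ₜ[k] z) = ψ T * z := by
    induction T with
    | zero => simp
    | add a b ha hb => rw [add_mul, map_add, ha, hb, map_add, add_mul]
    | tmul a b => simp [ψ, mul_assoc]
  have hψ (c : H 1) (z : H β) : ψ (C.comulOf h c * 1 ⊗ₜ[k] z) = C.counit c • z := by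
    rw [hψmul, show ψ (C.comulOf h c) = _ from C.mul_antipodeOf_rTensor h c,
      smul_mul_assoc, one_mul]
  have hS (z : H α) (r : Finset (H 1 × H α))
      (hr : C.comulOf (one_mul α) z = ∑ i ∈ r, i.1 ⊗ₜ[k] i.2) :
      C.antipodeOf h z = ∑ i ∈ r, C.counit i.1 • C.antipodeOf h i.2 := by
    conv_lhs => rw [← C.rTensor_counit_comulOf (one_mul α) z, hr]
    simp
  have hxy : (x * y) ⊗ₜ[k] (1 : H β) = ∑ i ∈ s, ∑ j ∈ t, C.comulOf h (i.1 * j.1) *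
      (1 ⊗ₜ[k] (C.antipodeOf h j.2 * C.antipodeOf h i.2)) := by
    calc (x * y) ⊗ₜ[k] (1 : H β) = x ⊗ₜ[k] (1 : H β) * y ⊗ₜ[k] (1 : H β) := by simp
      _ = ∑ i ∈ s, C.comulOf h i.1 * (y ⊗ₜ[k] (1 : H β)) * (1 ⊗ₜ[k] C.antipodeOf h i.2) := by
        rw [← hx, Finset.sum_mul]
        refine Finset.sum_congr rfl fun i _ => ?_
        simp [mul_assoc]
      _ = _ := by
        refine Finset.sum_congr rfl fun i _ => ?_
        rw [← hy, Finset.mul_sum, Finset.sum_mul]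
        refine Finset.sum_congr rfl fun j _ => ?_
        simp [mul_assoc]
  calc C.antipodeOf h (x * y) = ψ ((x * y) ⊗ₜ[k] (1 : H β)) := by simp [ψ]
    _ = _ := by
      rw [hxy, hS x s hs, hS y t ht]
      simp only [map_sum, hψ, Finset.sum_mul_sum]
      rw [Finset.sum_comm]
      refine Finset.sum_congr rfl fun j _ => Finset.sum_congr rfl fun i _ => ?_
      rw [map_mul, smul_mul_smul_comm, mul_comm]

/-! ### Pivots and the inverse antipode -/

namespace Pivot

variable {C : HopfGCoalgebra k H} (g : C.Pivot)

/-- The square of the antipode is conjugation by the pivot, so both composites are bijective. -/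
theorem antipodeOf_bijective (g : C.Pivot) {α β : G} (h : α * β = 1) :
    Function.Bijective (C.antipodeOf h) := by
  have key {α β : G} (h : α * β = 1) (h' : β * α = 1) :
      Function.Bijective (C.antipodeOf h' ∘ C.antipodeOf h) := by
    refine Function.bijective_iff_has_inverse.mpr
      ⟨fun x => ((g.toFun α)⁻¹ : (H α)ˣ) * x * (g.toFun α : H α), fun x => ?_, fun x => ?_⟩ <;>
    simp [g.antipodeOf_antipodeOf, mul_assoc]
  have h' : β * α = 1 := mul_eq_one_comm.mp h
  exact ⟨(key h h').1.of_comp, (key h' h).2.of_comp⟩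

theorem antipodeOf_apply {α β : G} (h : α * β = 1) :
    C.antipodeOf h (g.toFun α : H α) = ((g.toFun β)⁻¹ : (H β)ˣ) := by
  have := C.mul_antipodeOf_rTensor h (g.toFun 1 : H 1)
  rw [g.comulOf_apply h, g.counit_apply] at this
  exact Units.eq_inv_of_mul_eq_one_right (by simpa using this)

theorem antipodeOf_inv_apply {α β : G} (h : α * β = 1) :
    C.antipodeOf h ((g.toFun α)⁻¹ : (H α)ˣ) = (g.toFun β : H β) := by
  have := C.antipodeOf_mul h (g.toFun α : H α) ((g.toFun α)⁻¹ : (H α)ˣ)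
  rw [Units.mul_inv, C.antipodeOf_one, g.antipodeOf_apply h] at this
  simpa using Units.eq_inv_of_mul_eq_one_right this.symm

theorem counit_inv_apply : C.counit ((g.toFun 1)⁻¹ : (H 1)ˣ) = 1 := by
  have := congrArg C.counit (Units.mul_inv (g.toFun 1))
  simpa only [map_mul, g.counit_apply, one_mul, map_one] using this

theorem comulOf_inv_apply {α β γ : G} (h : α * β = γ) :
    C.comulOf h ((g.toFun γ)⁻¹ : (H γ)ˣ) =
      (((g.toFun α)⁻¹ : (H α)ˣ) : H α) ⊗ₜ[k] (((g.toFun β)⁻¹ : (H β)ˣ) : H β) := by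
  have h₁ : C.comulOf h (g.toFun γ : H γ) * C.comulOf h ((g.toFun γ)⁻¹ : (H γ)ˣ) = 1 := by
    rw [← map_mul, Units.mul_inv, map_one]
  have h₂ : (((g.toFun α)⁻¹ : (H α)ˣ) : H α) ⊗ₜ[k] (((g.toFun β)⁻¹ : (H β)ˣ) : H β) *
      C.comulOf h (g.toFun γ : H γ) = 1 := by
    simp [g.comulOf_apply h, Algebra.TensorProduct.one_def]
  exact (left_inv_eq_right_inv h₂ h₁).symm

/-- The inverse antipode `y ↦ g⁻¹ S(y) g`, from `H_α` to `H_β` where `αβ = 1`. -/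
def antipodeInv {α β : G} (h : α * β = 1) : H α →ₗ[k] H β :=
  LinearMap.mulLeft k (((g.toFun β)⁻¹ : (H β)ˣ) : H β) ∘ₗ
    LinearMap.mulRight k (g.toFun β : H β) ∘ₗ C.antipodeOf h

theorem antipodeInv_apply {α β : G} (h : α * β = 1) (x : H α) :
    g.antipodeInv h x =
      (((g.toFun β)⁻¹ : (H β)ˣ) : H β) * (C.antipodeOf h x * (g.toFun β : H β)) := rfl

theorem antipodeOf_antipodeInv {α β : G} (h : α * β = 1) (h' : β * α = 1) (x : H α) :
    C.antipodeOf h' (g.antipodeInv h x) = x := by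
  rw [antipodeInv_apply, C.antipodeOf_mul, C.antipodeOf_mul, g.antipodeOf_apply,
    g.antipodeOf_inv_apply, g.antipodeOf_antipodeOf]
  simp [mul_assoc]

theorem antipodeInv_antipodeOf {α β : G} (h : α * β = 1) (h' : β * α = 1) (x : H α) :
    g.antipodeInv h' (C.antipodeOf h x) = x := by
  rw [antipodeInv_apply, g.antipodeOf_antipodeOf]
  simp [mul_assoc]

theorem antipodeInv_mul {α β : G} (h : α * β = 1) (x y : H α) :
    g.antipodeInv h (x * y) = g.antipodeInv h y * g.antipodeInv h x := by
  simp [antipodeInv_apply, C.antipodeOf_mul, mul_assoc]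

/-- `∑ S⁻¹(b) a = ε(x) 1`, where `Δ(x) = ∑ a ⊗ b`. -/
theorem mul_antipodeInv_comm {α β : G} (h : α * β = 1) (h' : β * α = 1) (x : H 1) :
    LinearMap.mul' k (H α) ((g.antipodeInv h').rTensor (H α)
      (TensorProduct.comm k (H α) (H β) (C.comulOf h x))) = C.counit x • (1 : H α) := by
  apply (g.antipodeOf_bijective h).1
  rw [map_smul, C.antipodeOf_one, ← C.mul_antipodeOf_rTensor h x]
  generalize C.comulOf h x = T
  induction T with
  | zero => simp
  | add a b ha hb => simp only [map_add, ha, hb]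
  | tmul a b => simp [C.antipodeOf_mul, g.antipodeOf_antipodeInv]

/-- `∑ b S⁻¹(a) = ε(x) 1`, where `Δ(x) = ∑ a ⊗ b`. -/
theorem mul_antipodeInv_comm' {α β : G} (h : α * β = 1) (x : H 1) :
    LinearMap.mul' k (H β) ((g.antipodeInv h).lTensor (H β)
      (TensorProduct.comm k (H α) (H β) (C.comulOf h x))) = C.counit x • (1 : H β) := by
  have h' : β * α = 1 := mul_eq_one_comm.mp h
  apply (g.antipodeOf_bijective h').1
  rw [map_smul, C.antipodeOf_one, ← C.mul_antipodeOf_lTensor h h' x]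
  generalize C.comulOf h x = T
  induction T with
  | zero => simp
  | add a b ha hb => simp only [map_add, ha, hb]
  | tmul a b => simp [C.antipodeOf_mul, g.antipodeOf_antipodeInv]

/-- `∑ c₁ ⊗ S(d) g c₂ = y ⊗ g`, where `Δ(y) = ∑ c ⊗ d`; here `S(d) g = g S⁻¹(d)`. -/
theorem sum_antipodeOf_mul_comulOf {α β γ δ : G} (h₁ : α * β = δ)
    (h₂ : δ * γ = α) (h₃ : β * γ = 1) (h₄ : γ * β = 1) (y : H α) (s : Finset (H δ × H γ))
    (hs : C.comulOf h₂ y = ∑ i ∈ s, i.1 ⊗ₜ[k] i.2) :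
    ∑ i ∈ s, (1 : H α) ⊗ₜ[k] (C.antipodeOf h₄ i.2 * (g.toFun β : H β)) * C.comulOf h₁ i.1 =
      y ⊗ₜ[k] (g.toFun β : H β) := by
  let f : H β ⊗[k] H γ →ₗ[k] H β :=
    LinearMap.mulLeft k (g.toFun β : H β) ∘ₗ LinearMap.mul' k (H β) ∘ₗ
      (g.antipodeInv h₄).rTensor (H β) ∘ₗ (TensorProduct.comm k (H β) (H γ)).toLinearMap
  rw [← C.lTensor_comulOf_comulOf h₁ h₂ h₃ f (g.toFun β : H β)
    (fun w => by simp [f, g.mul_antipodeInv_comm h₃ h₄ w]) y, hs]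
  simp only [map_sum, LinearMap.rTensor_tmul]
  refine Finset.sum_congr rfl fun i _ => ?_
  generalize (i.2) = d
  have (T : H α ⊗[k] H β) : (1 : H α) ⊗ₜ[k] (C.antipodeOf h₄ d * (g.toFun β : H β)) * T =
      f.lTensor (H α) (TensorProduct.assoc k (H α) (H β) (H γ) (T ⊗ₜ[k] d)) := by
    induction T with
    | zero => simp
    | add a b ha hb => rw [mul_add, ha, hb]; simp only [TensorProduct.add_tmul, map_add]
    | tmul a b => simp [f, antipodeInv_apply, mul_assoc]
  exact this _

end Pivot
end HopfGCoalgebra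

/-! ### Cointegrals and Maschke's theorem -/

/-- A complement of the left ideal `ker ε` contains a left cointegral `Λ` with `ε(Λ) = 1`. -/
theorem IsSemisimpleMod.exists_cointegral {k : Type u} {G : Type w} {H : G → Type v} [Field k]
    [Group G] [∀ α, Ring (H α)] [∀ α, Algebra k (H α)] [FiniteDimensional k (H 1)]
    (C : HopfGCoalgebra k H) (hH : IsSemisimpleMod k (H 1)) :
    ∃ Λ : H 1, C.IsLeftCointegral Λ ∧ C.counit Λ = 1 := by
  have := hH (H 1)
  obtain ⟨J, hJ⟩ := exists_isCompl (RingHom.ker C.counit : Ideal (H 1))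
  obtain ⟨e, he, j, hj, hej⟩ := Submodule.mem_sup.mp
    (hJ.sup_eq_top ▸ Submodule.mem_top : (1 : H 1) ∈ RingHom.ker C.counit ⊔ J)
  have hε : C.counit j = 1 := by
    have := congrArg C.counit hej
    rwa [map_add, (RingHom.mem_ker).mp he, zero_add, map_one] at this
  refine ⟨j, fun x => ?_, hε⟩
  have hmem : (x - algebraMap k (H 1) (C.counit x)) * j ∈ RingHom.ker C.counit ⊓ J := by
    refine ⟨?_, J.smul_mem _ hj⟩
    rw [SetLike.mem_coe, RingHom.mem_ker]
    simp
  rw [hJ.inf_eq_bot, Submodule.mem_bot, sub_mul, sub_eq_zero] at hmem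
  rw [hmem, Algebra.smul_def]

namespace HopfGCoalgebra

variable {k : Type u} {G : Type w} {H : G → Type v} [Field k] [Group G]
  [∀ α, Ring (H α)] [∀ α, Algebra k (H α)] {C : HopfGCoalgebra k H}

/-- `Δ(Λ)(y ⊗ 1) = Δ(Λ)(1 ⊗ S(y))`: write `y ⊗ 1 = ∑ Δ(c)(1 ⊗ S(d))` with `Δ_{1,α}(y) = ∑ c ⊗ d`
and absorb `Δ(c)` into `Δ(Λ)`. -/
theorem IsRightCointegral.comulOf_mul {Λ : H 1} (hΛ : C.IsRightCointegral Λ) {α β : G}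
    (h : α * β = 1) (y : H α) :
    C.comulOf h Λ * y ⊗ₜ[k] (1 : H β) = C.comulOf h Λ * (1 : H α) ⊗ₜ[k] C.antipodeOf h y := by
  obtain ⟨s, hs⟩ := TensorProduct.exists_finset (C.comulOf (one_mul α) y)
  rw [← C.sum_comulOf_mul_antipodeOf h (one_mul α) (mul_eq_one_comm.mp h) h y s hs,
    Finset.mul_sum]
  conv_rhs => rw [← C.rTensor_counit_comulOf (one_mul α) y, hs]
  simp only [map_sum, TensorProduct.tmul_sum, Finset.mul_sum]
  refine Finset.sum_congr rfl fun i _ => ?_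
  rw [← mul_assoc, ← map_mul, hΛ]
  simp

namespace Pivot

/-- Maschke's theorem: `∑ S⁻¹(b) ⊗ a`, where `Δ(Λ) = ∑ a ⊗ b`, is a separability idempotent of
`H_α`, so averaging a `k`-linear projection with it gives an `H_α`-linear one. -/
theorem isSemisimpleMod_of_cointegral (g : C.Pivot) {Λ : H 1} (hΛ : C.IsRightCointegral Λ)
    (hε : C.counit Λ = 1) (α : G) : IsSemisimpleMod k (H α) := by
  intro V _ _ _ _ _
  have h : α * α⁻¹ = 1 := mul_inv_cancel α
  have h' : α⁻¹ * α = 1 := inv_mul_cancel α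
  refine (isSemisimpleModule_iff _ _).mpr ⟨fun W => ?_⟩
  obtain ⟨p, hp⟩ := (W.restrictScalars k).subtype.exists_leftInverse_of_injective
    (W.restrictScalars k).ker_subtype
  have hpW (w : W) : p w = w := LinearMap.congr_fun hp (w : W.restrictScalars k)
  -- `avg v (a ⊗ b) = S⁻¹(b) p(a v)`; the averaged projection is `v ↦ avg v (Δ(Λ))`.
  let avg (v : V) : H α ⊗[k] H α⁻¹ →ₗ[k] W.restrictScalars k := TensorProduct.lift
    (LinearMap.mk₂ k (fun a b => (⟨g.antipodeInv h' b • (p (a • v) : V),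
        W.smul_mem _ (p (a • v)).2⟩ : W.restrictScalars k))
      (fun a b c => by ext; simp [add_smul]) (fun r a b => by ext; simp [smul_comm _ r])
      (fun a b c => by ext; simp [add_smul]) (fun r a b => by ext; simp))
  have havg (v : V) (a : H α) (b : H α⁻¹) :
      (avg v (a ⊗ₜ b) : V) = g.antipodeInv h' b • (p (a • v) : V) := rfl
  have hadd (T : H α ⊗[k] H α⁻¹) (v w : V) : (avg (v + w) T : V) = avg v T + avg w T := by
    induction T with
    | zero => simp
    | add a b ha hb => simp only [map_add, Submodule.coe_add, ha, hb]; abel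
    | tmul a b => simp [havg]
  have hsmul (y : H α) (v : V) :
      (avg (y • v) (C.comulOf h Λ) : V) = y • (avg v (C.comulOf h Λ) : V) := by
    have h₁ (T : H α ⊗[k] H α⁻¹) :
        (avg (y • v) T : V) = avg v (T * y ⊗ₜ[k] (1 : H α⁻¹)) := by
      induction T with
      | zero => simp
      | add a b ha hb => rw [add_mul]; simp only [map_add, Submodule.coe_add, ha, hb]
      | tmul a b => simp [havg, mul_smul]
    have h₂ (T : H α ⊗[k] H α⁻¹) :
        (avg v (T * (1 : H α) ⊗ₜ[k] C.antipodeOf h y) : V) = y • (avg v T : V) := by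
      induction T with
      | zero => simp
      | add a b ha hb =>
        rw [add_mul]; simp only [map_add, Submodule.coe_add, ha, hb, smul_add]
      | tmul a b => simp [havg, g.antipodeInv_mul, g.antipodeInv_antipodeOf h h', mul_smul]
    rw [h₁, hΛ.comulOf_mul, h₂]
  let P : V →ₗ[H α] W :=
    { toFun := fun v => ⟨avg v (C.comulOf h Λ), (avg v (C.comulOf h Λ)).2⟩
      map_add' := fun v w => Subtype.ext (hadd _ v w)
      map_smul' := fun y v => Subtype.ext (hsmul y v) }
  refine ⟨LinearMap.ker P, LinearMap.isCompl_of_proj (f := P) fun w => Subtype.ext ?_⟩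
  change (avg (w : V) (C.comulOf h Λ) : V) = w
  have h₃ (T : H α ⊗[k] H α⁻¹) : (avg (w : V) T : V) =
      LinearMap.mul' k (H α) ((g.antipodeInv h').rTensor (H α)
        (TensorProduct.comm k (H α) (H α⁻¹) T)) • (w : V) := by
    induction T with
    | zero => simp
    | add a b ha hb => simp only [map_add, Submodule.coe_add, ha, hb, add_smul]
    | tmul a b =>
      rw [havg, show (p (a • (w : V)) : V) = a • (w : V) from
        congrArg Subtype.val (hpW (a • w))]
      simp [mul_smul]
  rw [h₃, g.mul_antipodeInv_comm h h', hε, one_smul, one_smul]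

/-! ### The trace form of the regular module -/

variable (g : C.Pivot)

/-- The linear form `h ↦ Tr(v ↦ g_α v h)` on `H_α`. -/
noncomputable def regTrace (α : G) : Module.Dual k (H α) :=
  LinearMap.trace k (H α) ∘ₗ
    LinearMap.mulLeft k (LinearMap.mulLeft k (g.toFun α : H α) : Module.End k (H α)) ∘ₗ
      (LinearMap.mul k (H α)).flip

theorem regTrace_apply (α : G) (h : H α) :
    g.regTrace α h = LinearMap.trace k (H α)
      (LinearMap.mulLeft k (g.toFun α : H α) ∘ₗ LinearMap.mulRight k h) := rfl

/-- An endomorphism of the regular module is right multiplication by its value at `1`. -/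
theorem rightTrace_eq_regTrace [∀ α, FiniteDimensional k (H α)] (α : G)
    (f : Module.End (H α) (H α)) : g.rightTrace α (H α) f = g.regTrace α (f 1) := by
  classical
  rw [regTrace_apply, LinearMap.trace_eq_matrix_trace k (Module.Basis.ofVectorSpace k (H α))]
  simp only [rightTrace, LinearMap.comp_apply, coevaluation_apply_one, map_sum, Matrix.trace,
    Matrix.diag, LinearMap.toMatrix_apply]
  refine Finset.sum_congr rfl fun i _ => ?_
  have hf (x : H α) : f x = x * f 1 := by simpa using f.map_smul x 1
  simp [evLeft, ← hf]

theorem leftTrace_eq_trace [∀ α, FiniteDimensional k (H α)] (α : G)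
    (f : Module.End (H α) (H α)) : g.leftTrace α (H α) f = LinearMap.trace k (H α)
      (LinearMap.mulLeft k (((g.toFun α)⁻¹ : (H α)ˣ) : H α) ∘ₗ LinearMap.mulRight k (f 1)) := by
  classical
  rw [LinearMap.trace_eq_matrix_trace k (Module.Basis.ofVectorSpace k (H α))]
  simp only [leftTrace, coevLeft, LinearMap.comp_apply, coevaluation_apply_one, map_sum,
    Matrix.trace, Matrix.diag, LinearMap.toMatrix_apply]
  refine Finset.sum_congr rfl fun i _ => ?_
  have hf (x : H α) : f x = x * f 1 := by simpa using f.map_smul x 1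
  simp [mul_assoc, hf (_ * _)]

/-- The operator `v ↦ ∑ p(w₁) g w₂` on `H_α`, where `w = vh` and `p` is a linear form on `H_1`. -/
noncomputable def cointegralOp {α : G} (h : H α) (p : Module.Dual k (H 1)) :
    Module.End k (H α) :=
  LinearMap.mulLeft k (g.toFun α : H α) ∘ₗ (TensorProduct.lid k (H α)).toLinearMap ∘ₗ
    p.rTensor (H α) ∘ₗ (C.comulOf (one_mul α)).toLinearMap ∘ₗ LinearMap.mulRight k h

theorem cointegralOp_apply {α : G} (h : H α) (p : Module.Dual k (H 1)) (v : H α) :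
    g.cointegralOp h p v = (g.toFun α : H α) *
      TensorProduct.lid k (H α) (p.rTensor (H α) (C.comulOf (one_mul α) (v * h))) := rfl

theorem cointegralOp_counit {α : G} (h : H α) :
    g.cointegralOp h C.counit.toLinearMap =
      LinearMap.mulLeft k (g.toFun α : H α) ∘ₗ LinearMap.mulRight k h := by
  ext v
  rw [cointegralOp_apply, C.rTensor_counit_comulOf]
  rfl

/-- Left translation of `p` by `x ∈ H_1` turns the operator of `p` into a sum of two-sided products
`S(b) · a`, where `Δ(x) = ∑ a ⊗ b`; by cyclicity only `∑ a S(b) = ε(x)` survives in the trace. -/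
theorem trace_cointegralOp_mulLeft {α : G} [FiniteDimensional k (H α)] (h : H α)
    (p : Module.Dual k (H 1)) (x : H 1) :
    LinearMap.trace k (H α) (g.cointegralOp h (p ∘ₗ LinearMap.mulLeft k x)) =
      C.counit x * LinearMap.trace k (H α) (g.cointegralOp h p) := by
  have e₁ : α * α⁻¹ = 1 := mul_inv_cancel α
  have e₂ : α⁻¹ * α = 1 := inv_mul_cancel α
  obtain ⟨s, hs⟩ := TensorProduct.exists_finset (C.comulOf e₁ x)
  have hx := g.sum_antipodeOf_mul_comulOf (one_mul α) e₁ e₁ e₂ x s hs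
  have hop : g.cointegralOp h (p ∘ₗ LinearMap.mulLeft k x) = ∑ i ∈ s,
      LinearMap.mulLeft k (C.antipodeOf e₂ i.2) ∘ₗ g.cointegralOp h p ∘ₗ
        LinearMap.mulLeft k i.1 := by
    ext v
    have h₁ (T : H 1 ⊗[k] H α) : (g.toFun α : H α) * TensorProduct.lid k (H α)
        ((p ∘ₗ LinearMap.mulLeft k x).rTensor (H α) T) =
        TensorProduct.lid k (H α) (p.rTensor (H α) (x ⊗ₜ[k] (g.toFun α : H α) * T)) := by
      induction T with
      | zero => simp
      | add a b ha hb => simp only [map_add, mul_add, ha, hb]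
      | tmul a b => simp
    have h₂ (T : H 1 ⊗[k] H α) (d : H α) : d * TensorProduct.lid k (H α) (p.rTensor (H α) T) =
        TensorProduct.lid k (H α) (p.rTensor (H α) ((1 : H 1) ⊗ₜ[k] d * T)) := by
      induction T with
      | zero => simp
      | add a b ha hb => simp only [map_add, mul_add, ha, hb]
      | tmul a b => simp
    rw [cointegralOp_apply, h₁, ← hx]
    simp only [LinearMap.sum_apply, LinearMap.comp_apply, LinearMap.mulLeft_apply,
      Finset.sum_mul, map_sum]
    refine Finset.sum_congr rfl fun i _ => ?_
    rw [cointegralOp_apply, ← mul_assoc (C.antipodeOf e₂ i.2), h₂, mul_assoc i.1 v h,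
      map_mul _ i.1, mul_assoc]
  have hε : ∑ i ∈ s, i.1 * C.antipodeOf e₂ i.2 = C.counit x • (1 : H α) := by
    rw [← C.mul_antipodeOf_lTensor e₁ e₂ x, hs]
    simp
  have hcyc (i : H α × H α⁻¹) : LinearMap.trace k (H α)
      (LinearMap.mulLeft k (C.antipodeOf e₂ i.2) ∘ₗ g.cointegralOp h p ∘ₗ
        LinearMap.mulLeft k i.1) = LinearMap.trace k (H α)
      (g.cointegralOp h p ∘ₗ LinearMap.mulLeft k (i.1 * C.antipodeOf e₂ i.2)) := by
    rw [LinearMap.trace_comp_comm', LinearMap.comp_assoc, LinearMap.mulLeft_mul]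
  rw [hop, map_sum, Finset.sum_congr rfl fun i _ => hcyc i, ← map_sum]
  have : ∑ i ∈ s, g.cointegralOp h p ∘ₗ LinearMap.mulLeft k (i.1 * C.antipodeOf e₂ i.2) =
      C.counit x • g.cointegralOp h p := by
    ext v
    simp only [LinearMap.sum_apply, LinearMap.comp_apply, LinearMap.mulLeft_apply, ← map_sum,
      ← Finset.sum_mul, hε, smul_mul_assoc, one_mul, map_smul, LinearMap.smul_apply]
  rw [this, map_smul, smul_eq_mul]

/-- Every value of the trace form is the counit of a left cointegral. -/
theorem exists_cointegral_counit_eq_regTrace [∀ α, FiniteDimensional k (H α)] {α : G} (h : H α) :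
    ∃ Λ : H 1, C.IsLeftCointegral Λ ∧ C.counit Λ = g.regTrace α h := by
  -- The partial trace defining `Λ` is described by its pairing with linear forms on `H_1`.
  let φ : Module.Dual k (Module.Dual k (H 1)) :=
    { toFun := fun p => LinearMap.trace k (H α) (g.cointegralOp h p)
      map_add' := fun p q => by
        rw [← map_add]; congr 1; ext v; simp [cointegralOp_apply, LinearMap.rTensor_add, mul_add]
      map_smul' := fun r p => by
        rw [← map_smul]; congr 1; ext v; simp [cointegralOp_apply, LinearMap.rTensor_smul] }
  obtain ⟨Λ, hΛ⟩ := (Module.evalEquiv k (H 1)).surjective φ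
  have hp (p : Module.Dual k (H 1)) : p Λ = LinearMap.trace k (H α) (g.cointegralOp h p) :=
    LinearMap.congr_fun hΛ p
  refine ⟨Λ, fun x => ?_, ?_⟩
  · refine (Module.evalEquiv k (H 1)).injective (LinearMap.ext fun p => ?_)
    have := hp (p ∘ₗ LinearMap.mulLeft k x)
    rw [g.trace_cointegralOp_mulLeft, ← hp] at this
    simpa using this
  · have := hp C.counit.toLinearMap
    rwa [g.cointegralOp_counit] at this

/-! ### The integral given by the trace form -/

/-- `∑ t_α(h₁) p(g h₂) = p(1) t_{αβ}(h)` for the trace form `t`. With a basis `(bᵢ)` of `H_β` and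
its dual basis, the operator on the left is the sum of the `T_{bⁱ} ∘ (v ↦ g v h) ∘ T_{p(S(·)bᵢ)}`,
where `T_q` contracts the coproduct with `q`; by cyclicity of the trace it may be replaced
by `(v ↦ g v h) ∘ T_{p(S(·)bᵢ)} ∘ T_{bⁱ}`, and `∑ T_{p(S(·)bᵢ)} ∘ T_{bⁱ} = p(1)`. -/
theorem regTrace_contract [∀ α, FiniteDimensional k (H α)] {α β γ : G} (e : α * β = γ)
    (p : Module.Dual k (H β)) (h : H γ) :
    g.regTrace α (TensorProduct.rid k (H α) (p.lTensor (H α)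
      ((1 : H α) ⊗ₜ[k] (g.toFun β : H β) * C.comulOf e h))) = p 1 * g.regTrace γ h := by
  have e₁ : γ * β⁻¹ = α := by rw [← e, mul_inv_cancel_right]
  have e₂ : β * β⁻¹ = 1 := mul_inv_cancel β
  have e₃ : β⁻¹ * β = 1 := inv_mul_cancel β
  let b := Module.Basis.ofVectorSpace k (H β)
  let q (i) : Module.Dual k (H β⁻¹) := p ∘ₗ LinearMap.mulRight k (b i) ∘ₗ C.antipodeOf e₃
  set c := TensorProduct.rid k (H α) (p.lTensor (H α)
      ((1 : H α) ⊗ₜ[k] (g.toFun β : H β) * C.comulOf e h)) with hc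
  set F : Module.End k (H γ) :=
    LinearMap.mulLeft k (g.toFun γ : H γ) ∘ₗ LinearMap.mulRight k h with hF
  have hsum (d : H β⁻¹) (z : H β) :
      ∑ i, b.coord i z * p (C.antipodeOf e₃ d * b i) = p (C.antipodeOf e₃ d * z) := by
    conv_rhs => rw [← b.sum_repr z]
    simp only [Finset.mul_sum, map_sum, mul_smul_comm, map_smul, smul_eq_mul, b.coord_apply]
  have hsumT (d : H β⁻¹) (T : H α ⊗[k] H β) :
      ∑ i, p (C.antipodeOf e₃ d * b i) •
        TensorProduct.rid k (H α) ((b.coord i).lTensor (H α) T) =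
      TensorProduct.rid k (H α) (p.lTensor (H α) ((1 : H α) ⊗ₜ[k] C.antipodeOf e₃ d * T)) := by
    induction T with
    | zero => simp
    | add x y hx hy => simp only [map_add, smul_add, mul_add, Finset.sum_add_distrib, hx, hy]
    | tmul x y =>
      simp only [LinearMap.lTensor_tmul, TensorProduct.rid_tmul, smul_smul, ← Finset.sum_smul,
        Algebra.TensorProduct.tmul_mul_tmul, one_mul]
      rw [← hsum d y]
      simp only [mul_comm]
  have hop : LinearMap.mulLeft k (g.toFun α : H α) ∘ₗ LinearMap.mulRight k c =
      ∑ i, C.contractOf e (b.coord i) ∘ₗ F ∘ₗ C.contractOf e₁ (q i) := by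
    ext v
    obtain ⟨s, hs⟩ := TensorProduct.exists_finset (C.comulOf e₁ v)
    have hv := g.sum_antipodeOf_mul_comulOf e e₁ e₂ e₃ v s hs
    have h₁ (T : H α ⊗[k] H β) : (g.toFun α : H α) * (v * TensorProduct.rid k (H α)
        (p.lTensor (H α) ((1 : H α) ⊗ₜ[k] (g.toFun β : H β) * T))) = TensorProduct.rid k (H α)
        (p.lTensor (H α) ((g.toFun α : H α) ⊗ₜ[k] (1 : H β) *
          (v ⊗ₜ[k] (g.toFun β : H β) * T))) := by
      induction T with
      | zero => simp
      | add x y hx hy => simp only [map_add, mul_add, hx, hy]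
      | tmul x y => simp
    have h₂ (x : H γ) : C.comulOf e (F x) = (g.toFun α : H α) ⊗ₜ[k] (g.toFun β : H β) *
        (C.comulOf e x * C.comulOf e h) := by
      simp [hF, g.comulOf_apply e]
    calc _ = TensorProduct.rid k (H α) (p.lTensor (H α) ((g.toFun α : H α) ⊗ₜ[k] (1 : H β) *
          (v ⊗ₜ[k] (g.toFun β : H β) * C.comulOf e h))) := h₁ _
      _ = ∑ j ∈ s, TensorProduct.rid k (H α) (p.lTensor (H α)
          ((1 : H α) ⊗ₜ[k] C.antipodeOf e₃ j.2 * C.comulOf e (F j.1))) := by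
        rw [← hv, Finset.sum_mul, Finset.mul_sum, map_sum, map_sum]
        refine Finset.sum_congr rfl fun j _ => ?_
        rw [h₂]
        simp only [← mul_assoc, Algebra.TensorProduct.tmul_mul_tmul, one_mul, mul_one]
      _ = _ := by
        simp only [← hsumT, LinearMap.sum_apply, LinearMap.comp_apply]
        rw [Finset.sum_comm]
        refine Finset.sum_congr rfl fun i _ => ?_
        rw [C.contractOf_apply e₁, hs]
        simp only [map_sum, LinearMap.lTensor_tmul, TensorProduct.rid_tmul, map_smul]
        rfl
  have hid : ∑ i, C.contractOf e₁ (q i) ∘ₗ C.contractOf e (b.coord i) =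
      p 1 • (LinearMap.id : H γ →ₗ[k] H γ) := by
    ext v
    let f : H β⁻¹ ⊗[k] H β →ₗ[k] k :=
      p ∘ₗ LinearMap.mul' k (H β) ∘ₗ (C.antipodeOf e₃).rTensor (H β)
    have hf := C.lTensor_comulOf_comulOf e₁ e e₃ f (p 1)
      (fun w => by simp [f, C.mul_antipodeOf_rTensor e₃ w]) v
    have h₁ (T : H α ⊗[k] H β) : ∑ i, C.contractOf e₁ (q i)
        (TensorProduct.rid k (H α) ((b.coord i).lTensor (H α) T)) =
        TensorProduct.rid k (H γ) (f.lTensor (H γ) (TensorProduct.assoc k (H γ) (H β⁻¹) (H β)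
          ((C.comulOf e₁).toLinearMap.rTensor (H β) T))) := by
      induction T with
      | zero => simp
      | add x y hx hy => simp only [map_add, Finset.sum_add_distrib, hx, hy]
      | tmul x y =>
        simp only [LinearMap.lTensor_tmul, TensorProduct.rid_tmul, LinearMap.rTensor_tmul,
          map_smul, C.contractOf_apply, AlgHom.toLinearMap_apply]
        generalize C.comulOf e₁ x = U
        induction U with
        | zero => simp
        | add x y hx hy =>
          simp only [map_add, smul_add, Finset.sum_add_distrib, TensorProduct.add_tmul, hx, hy]
        | tmul x d =>
          simp only [LinearMap.lTensor_tmul, TensorProduct.rid_tmul, smul_smul,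
            ← Finset.sum_smul, TensorProduct.assoc_tmul]
          congr 1
          exact hsum d y
    rw [LinearMap.sum_apply]
    have h₂ := h₁ (C.comulOf e v)
    rw [hf] at h₂
    exact h₂.trans (by simp)
  rw [regTrace_apply, hop, map_sum, regTrace_apply, ← hF]
  calc _ = ∑ i, LinearMap.trace k (H γ)
        (F ∘ₗ C.contractOf e₁ (q i) ∘ₗ C.contractOf e (b.coord i)) :=
        Finset.sum_congr rfl fun i _ => by
          rw [LinearMap.trace_comp_comm', LinearMap.comp_assoc]
    _ = LinearMap.trace k (H γ) (F ∘ₗ (p 1 • (LinearMap.id : H γ →ₗ[k] H γ))) := by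
        rw [← map_sum, ← hid]
        refine congrArg (LinearMap.trace k (H γ)) (LinearMap.ext fun v => ?_)
        simp only [LinearMap.sum_apply, LinearMap.comp_apply, map_sum]
    _ = _ := by rw [LinearMap.comp_smul, LinearMap.comp_id, map_smul, smul_eq_mul]

/-- The family `x ↦ t_α(g⁻¹ x)`, where `t` is the trace form; the trace form is its
symmetrisation. -/
noncomputable def traceIntegral (g : C.Pivot) (α : G) : Module.Dual k (H α) :=
  g.regTrace α ∘ₗ LinearMap.mulLeft k (((g.toFun α)⁻¹ : (H α)ˣ) : H α)

theorem symRight_traceIntegral (g : C.Pivot) (α : G) (x : H α) :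
    g.symRight g.traceIntegral α x = g.regTrace α x := by
  simp [symRight, traceIntegral]

/-- The identity `regTrace_contract`, read at `h = g⁻¹ x`. -/
theorem isRightIntegral_traceIntegral [∀ α, FiniteDimensional k (H α)] (g : C.Pivot) :
    C.IsRightIntegral g.traceIntegral := by
  intro α β x
  refine (Module.evalEquiv k (H β)).injective (LinearMap.ext fun p => ?_)
  change p _ = p _
  have h₁ (T : H α ⊗[k] H β) : p (TensorProduct.lid k (H β)
      ((g.traceIntegral α).rTensor (H β) T)) = g.regTrace α (TensorProduct.rid k (H α)
        (p.lTensor (H α) ((((g.toFun α)⁻¹ : (H α)ˣ) : H α) ⊗ₜ[k] (1 : H β) * T))) := by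
    induction T with
    | zero => simp
    | add a b ha hb => simp only [map_add, mul_add, ha, hb]
    | tmul a b => simp [traceIntegral, mul_comm]
  have h₂ : (((g.toFun α)⁻¹ : (H α)ˣ) : H α) ⊗ₜ[k] (1 : H β) =
      (1 : H α) ⊗ₜ[k] (g.toFun β : H β) *
        C.comulOf rfl (((g.toFun (α * β))⁻¹ : (H (α * β))ˣ) : H (α * β)) := by
    simp [g.comulOf_inv_apply]
  rw [h₁, h₂, mul_assoc, ← C.comulOf_rfl, ← map_mul, g.regTrace_contract rfl p, map_smul,
    smul_eq_mul, mul_comm]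
  rfl

/-- On `H_1` the operator `v ↦ g v g⁻¹ Λ` is `v ↦ ε(v) Λ`, whose trace is `ε(Λ)`. -/
theorem traceIntegral_cointegral [∀ α, FiniteDimensional k (H α)] (g : C.Pivot) {Λ : H 1}
    (hΛ : C.IsLeftCointegral Λ) : g.traceIntegral 1 Λ = C.counit Λ := by
  have hop : (LinearMap.mulLeft k (g.toFun 1 : H 1) ∘ₗ LinearMap.mulRight k
      ((((g.toFun 1)⁻¹ : (H 1)ˣ) : H 1) * Λ)) = C.counit.toLinearMap.smulRight Λ := by
    ext v
    simp [hΛ _, g.counit_apply, g.counit_inv_apply]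
  change g.regTrace 1 _ = _
  rw [regTrace_apply]
  simp only [LinearMap.mulLeft_apply]
  rw [hop, LinearMap.trace_smulRight]
  rfl

end Pivot

/-! ### Uniqueness of integrals -/

/-- `(μ_α ⊗ id)(Δ(Λ)(y ⊗ 1)) = μ_1(Λ) S(y)`. -/
theorem IsRightIntegral.lid_rTensor_comulOf_mul {μ : ∀ α, Module.Dual k (H α)}
    (hμ : C.IsRightIntegral μ) {Λ : H 1} (hΛ : C.IsRightCointegral Λ) {α β : G} (h : α * β = 1)
    (y : H α) :
    TensorProduct.lid k (H β) ((μ α).rTensor (H β) (C.comulOf h Λ * y ⊗ₜ[k] (1 : H β))) =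
      μ 1 Λ • C.antipodeOf h y := by
  have h₁ (T : H α ⊗[k] H β) (z : H β) : TensorProduct.lid k (H β)
      ((μ α).rTensor (H β) (T * (1 : H α) ⊗ₜ[k] z)) =
      TensorProduct.lid k (H β) ((μ α).rTensor (H β) T) * z := by
    induction T with
    | zero => simp
    | add a b ha hb => simp only [map_add, add_mul, ha, hb]
    | tmul a b => simp
  rw [hΛ.comulOf_mul, h₁, hμ.comulOf h, smul_mul_assoc, one_mul]

/-- If some right integral takes a non-zero value at a right cointegral `Λ`, then a right integral
vanishing at `Λ` is zero. The map `φ ↦ (id ⊗ φ) Δ(Λ)` from `H_{α⁻¹}^*` to `H_α` is injective, as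
the first integral composed with it is given by the antipode, hence surjective; the second
integral vanishes on its image. -/
theorem IsRightIntegral.eq_zero_of_apply_cointegral [∀ α, FiniteDimensional k (H α)]
    (g : C.Pivot) {μ ν : ∀ α, Module.Dual k (H α)} (hμ : C.IsRightIntegral μ)
    (hν : C.IsRightIntegral ν) {Λ : H 1} (hΛ : C.IsRightCointegral Λ) (hμΛ : μ 1 Λ ≠ 0)
    (hνΛ : ν 1 Λ = 0) : ν = 0 := by
  funext α
  have h : α * α⁻¹ = 1 := mul_inv_cancel α
  have hS := g.antipodeOf_bijective h
  let E : Module.Dual k (H α⁻¹) →ₗ[k] H α :=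
    { toFun := fun φ => C.contractOf h φ Λ
      map_add' := fun φ ψ => by simp [C.contractOf_apply, LinearMap.lTensor_add]
      map_smul' := fun r φ => by simp [C.contractOf_apply, LinearMap.lTensor_smul] }
  have hE {ρ : ∀ α, Module.Dual k (H α)} (hρ : C.IsRightIntegral ρ)
      (φ : Module.Dual k (H α⁻¹)) (y : H α) :
      ρ α (E φ * y) = ρ 1 Λ * φ (C.antipodeOf h y) := by
    have h₁ (T : H α ⊗[k] H α⁻¹) :
        ρ α (TensorProduct.rid k (H α) (φ.lTensor (H α) T) * y) =
          φ (TensorProduct.lid k (H α⁻¹) ((ρ α).rTensor (H α⁻¹) (T * y ⊗ₜ[k] (1 : H α⁻¹)))) := by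
      induction T with
      | zero => simp
      | add a b ha hb => simp only [map_add, add_mul, ha, hb]
      | tmul a b => simp [mul_comm]
    refine (h₁ (C.comulOf h Λ)).trans ?_
    rw [hρ.lid_rTensor_comulOf_mul hΛ, map_smul, smul_eq_mul]
  have hinj : Function.Injective E := by
    refine (injective_iff_map_eq_zero E).mpr fun φ hφ => LinearMap.ext fun z => ?_
    obtain ⟨y, rfl⟩ := hS.2 z
    have := hE hμ φ y
    rw [hφ, zero_mul, map_zero] at this
    exact (mul_eq_zero.mp this.symm).resolve_left hμΛ
  have hdim : Module.finrank k (Module.Dual k (H α⁻¹)) = Module.finrank k (H α) := by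
    rw [Subspace.dual_finrank_eq, (LinearEquiv.ofBijective _ hS).finrank_eq]
  have hsurj : Function.Surjective E :=
    (LinearMap.injective_iff_surjective_of_finrank_eq_finrank hdim).mp hinj
  ext y
  obtain ⟨φ, rfl⟩ := hsurj y
  simpa [hνΛ] using hE hν φ 1

/-- If `μ_α = 0`, then `μ_1(Λ) S(1) = 0` in `H_{α⁻¹}`. -/
theorem IsRightIntegral.ne_zero_of_apply_cointegral (g : C.Pivot)
    {μ : ∀ α, Module.Dual k (H α)} (hμ : C.IsRightIntegral μ) {Λ : H 1}
    (hΛ : C.IsRightCointegral Λ) (hμΛ : μ 1 Λ ≠ 0) (α : G) [Nontrivial (H α)] : μ α ≠ 0 := by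
  intro h0
  have h : α * α⁻¹ = 1 := mul_inv_cancel α
  have := hμ.lid_rTensor_comulOf_mul hΛ h 1
  rw [h0, LinearMap.rTensor_zero, LinearMap.zero_apply, map_zero, eq_comm, smul_eq_zero] at this
  exact one_ne_zero ((g.antipodeOf_bijective h).1
    ((this.resolve_left hμΛ).trans (map_zero _).symm))

theorem IsRightIntegral.sub_smul {μ ν : ∀ α, Module.Dual k (H α)} (hμ : C.IsRightIntegral μ)
    (hν : C.IsRightIntegral ν) (r : k) : C.IsRightIntegral (ν - r • μ) := by
  intro α β x
  simp [LinearMap.rTensor_sub, LinearMap.rTensor_smul, hμ α β x, hν α β x,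
    _root_.sub_smul, smul_smul]

/-! ### Traces and semisimplicity -/

theorem IsUnimodular.exists_cointegral [∀ α, FiniteDimensional k (H α)] (hC : C.IsUnimodular)
    (hH : IsSemisimpleMod k (H 1)) :
    ∃ Λ : H 1, C.IsLeftCointegral Λ ∧ C.IsRightCointegral Λ ∧ C.counit Λ = 1 := by
  obtain ⟨Λ, hΛ, hε⟩ := hH.exists_cointegral C
  exact ⟨Λ, hΛ, (hC Λ).mp hΛ, hε⟩

theorem IsUnimodular.isSemisimpleMod_iff [∀ α, FiniteDimensional k (H α)] (hC : C.IsUnimodular)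
    (g : C.Pivot) : (∀ β : G, IsSemisimpleMod k (H β)) ↔ IsSemisimpleMod k (H 1) := by
  refine ⟨fun h => h 1, fun h => ?_⟩
  obtain ⟨Λ, -, hΛ, hε⟩ := hC.exists_cointegral h
  exact g.isSemisimpleMod_of_cointegral hΛ hε

theorem Pivot.rightTrace_ne_zero_iff [∀ α, FiniteDimensional k (H α)] (g : C.Pivot)
    (hC : C.IsUnimodular) (α : G) [Nontrivial (H α)] :
    g.rightTrace α (H α) ≠ 0 ↔ ∀ β : G, IsSemisimpleMod k (H β) := by
  constructor
  · intro h
    obtain ⟨f, hf⟩ := Function.ne_iff.mp h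
    rw [g.rightTrace_eq_regTrace] at hf
    obtain ⟨Λ, hΛ, hε⟩ := g.exists_cointegral_counit_eq_regTrace (f 1)
    refine g.isSemisimpleMod_of_cointegral (Λ := (C.counit Λ)⁻¹ • Λ) (fun x => ?_) ?_
    · rw [smul_mul_assoc, (hC Λ).mp hΛ x, smul_comm]
    · rw [map_smul, smul_eq_mul, inv_mul_cancel₀]
      rwa [hε]
  · intro h h0
    obtain ⟨Λ, hΛ, hΛ', hε⟩ := hC.exists_cointegral (h 1)
    refine g.isRightIntegral_traceIntegral.ne_zero_of_apply_cointegral g hΛ'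
      (by rw [g.traceIntegral_cointegral hΛ, hε]; exact one_ne_zero) α ?_
    have hreg (x : H α) : g.regTrace α x = 0 := by
      simpa [g.rightTrace_eq_regTrace] using congrFun h0 (LinearMap.toSpanSingleton (H α) (H α) x)
    exact LinearMap.ext fun x => hreg _

/-- The integral attached to the trace form takes the value `1` at the normalised cointegral `Λ`, so
any right integral `μ` is `μ_1(Λ)` times it and the constant is `μ_1(Λ)⁻¹`. -/
theorem Pivot.rightTrace_eq_integral [∀ α, FiniteDimensional k (H α)] (g : C.Pivot)
    (hC : C.IsUnimodular) (hH : IsSemisimpleMod k (H 1)) :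
    (∃ μ : ∀ α, Module.Dual k (H α), C.IsRightIntegral μ ∧ μ ≠ 0) ∧
      ∀ μ : ∀ α, Module.Dual k (H α), C.IsRightIntegral μ → μ ≠ 0 →
        ∃ c : k, c ≠ 0 ∧ ∀ (α : G) (f : Module.End (H α) (H α)),
          g.rightTrace α (H α) f = c * g.symRight μ α (f 1) := by
  obtain ⟨Λ, hΛ, hΛ', hε⟩ := hC.exists_cointegral hH
  have hτ := g.isRightIntegral_traceIntegral
  have hτΛ : g.traceIntegral 1 Λ = 1 := (g.traceIntegral_cointegral hΛ).trans hε
  have hτΛ0 : g.traceIntegral 1 Λ ≠ 0 := by rw [hτΛ]; exact one_ne_zero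
  refine ⟨⟨g.traceIntegral, hτ, fun h0 => hτΛ0 (by rw [h0]; rfl)⟩, fun μ hμ hμ0 => ?_⟩
  have hμΛ : μ 1 Λ ≠ 0 := fun h =>
    hμ0 (hτ.eq_zero_of_apply_cointegral g hμ hΛ' hτΛ0 h)
  have heq : μ - μ 1 Λ • g.traceIntegral = 0 :=
    hτ.eq_zero_of_apply_cointegral g (hτ.sub_smul hμ _) hΛ' hτΛ0 (by simp [hτΛ])
  refine ⟨(μ 1 Λ)⁻¹, inv_ne_zero hμΛ, fun α f => ?_⟩
  rw [g.rightTrace_eq_regTrace, ← g.symRight_traceIntegral]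
  have : μ α = μ 1 Λ • g.traceIntegral α := congrFun (sub_eq_zero.mp heq) α
  simp [symRight, this, inv_mul_cancel_left₀ hμΛ]

end HopfGCoalgebra

/-! ### The co-opposite Hopf coalgebra -/

section Reversal

variable {k : Type*} [Field k] {U V W X : Type*} [AddCommGroup U] [AddCommGroup V]
  [AddCommGroup W] [AddCommGroup X] [Module k U] [Module k V] [Module k W] [Module k X]

theorem TensorProduct.assoc_rTensor_comm (f : X →ₗ[k] V ⊗[k] W) (T : U ⊗[k] X) :
    TensorProduct.assoc k W V U
        (((TensorProduct.comm k V W).toLinearMap ∘ₗ f).rTensor U (TensorProduct.comm k U X T)) =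
      (TensorProduct.comm k U V).toLinearMap.lTensor W (TensorProduct.comm k (U ⊗[k] V) W
        ((TensorProduct.assoc k U V W).symm (f.lTensor U T))) := by
  induction T with
  | zero => simp
  | add a b ha hb => simp only [map_add, ha, hb]
  | tmul u x =>
    simp only [TensorProduct.comm_tmul, LinearMap.rTensor_tmul, LinearMap.lTensor_tmul,
      LinearMap.comp_apply]
    generalize f x = S
    induction S with
    | zero => simp
    | add a b ha hb => simp only [map_add, TensorProduct.add_tmul, TensorProduct.tmul_add, ha, hb]
    | tmul a b => simp

theorem TensorProduct.lTensor_comp_comm (f : X →ₗ[k] U ⊗[k] V) (T : X ⊗[k] W) :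
    ((TensorProduct.comm k U V).toLinearMap ∘ₗ f).lTensor W (TensorProduct.comm k X W T) =
      (TensorProduct.comm k U V).toLinearMap.lTensor W
        (TensorProduct.comm k (U ⊗[k] V) W (f.rTensor W T)) := by
  induction T with
  | zero => simp
  | add a b ha hb => simp only [map_add, ha, hb]
  | tmul u x => simp

theorem TensorProduct.lid_rTensor_comm (f : U →ₗ[k] k) (T : V ⊗[k] U) :
    TensorProduct.lid k V (f.rTensor V (TensorProduct.comm k V U T)) =
      TensorProduct.rid k V (f.lTensor V T) := by
  induction T with
  | zero => simp
  | add a b ha hb => simp only [map_add, ha, hb]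
  | tmul u x => simp

theorem TensorProduct.rid_lTensor_comm (f : U →ₗ[k] k) (T : U ⊗[k] V) :
    TensorProduct.rid k V (f.lTensor V (TensorProduct.comm k U V T)) =
      TensorProduct.lid k V (f.rTensor V T) := by
  induction T with
  | zero => simp
  | add a b ha hb => simp only [map_add, ha, hb]
  | tmul u x => simp

end Reversal

namespace HopfGCoalgebra

open MulOpposite

/-- The transports of the family indexed by `Gᵐᵒᵖ` are those of the original family. -/
theorem cast_unop {k : Type u} {G : Type w} {H : G → Type v} [Field k]
    [∀ α, Ring (H α)] [∀ α, Algebra k (H α)] {a b : Gᵐᵒᵖ} (h : a = b) (x : H a.unop) :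
    AlgEquiv.cast (R := k) (A := fun a : Gᵐᵒᵖ => H a.unop) h x =
      AlgEquiv.cast (R := k) (A := H) (congrArg unop h) x := by
  subst h
  rfl

variable {k : Type u} {G : Type w} {H : G → Type v} [Field k] [Group G]
  [∀ α, Ring (H α)] [∀ α, Algebra k (H α)] {C : HopfGCoalgebra k H}

namespace Pivot

theorem cast_antipodeInv (g : C.Pivot) {α β γ : G} (h : α * β = 1) (h' : α * γ = 1) (e : β = γ)
    (x : H α) :
    AlgEquiv.cast (R := k) (A := H) e (g.antipodeInv h x) = g.antipodeInv h' x := by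
  subst e
  rfl

/-- The co-opposite of a pivotal Hopf `G`-coalgebra: the same algebras, indexed by the opposite
group, with the flipped coproducts and the inverse antipode. It exchanges left and right. -/
noncomputable def coop (g : C.Pivot) : HopfGCoalgebra k (fun a : Gᵐᵒᵖ => H a.unop) where
  comul a b := (Algebra.TensorProduct.comm k (H b.unop) (H a.unop) :
    H b.unop ⊗[k] H a.unop →ₐ[k] H a.unop ⊗[k] H b.unop).comp (C.comul b.unop a.unop)
  counit := C.counit
  antipode a := g.antipodeInv (mul_inv_cancel a.unop)
  coassoc a b c x := by
    have h := C.comulOf_coassoc (rfl : c.unop * b.unop = c.unop * b.unop)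
      (mul_assoc c.unop b.unop a.unop) (rfl : b.unop * a.unop = b.unop * a.unop) rfl x
    refine (TensorProduct.assoc_rTensor_comm (C.comul b.unop a.unop).toLinearMap
      (C.comul c.unop (b.unop * a.unop) x)).trans ?_
    rw [cast_unop]
    refine Eq.trans ?_ (TensorProduct.lTensor_comp_comm (C.comul c.unop b.unop).toLinearMap
      (C.comulOf (mul_assoc c.unop b.unop a.unop) x)).symm
    exact congrArg (fun T => (TensorProduct.comm k _ _).toLinearMap.lTensor _
      (TensorProduct.comm k _ _ T)) ((LinearEquiv.symm_apply_eq _).mpr h.symm)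
  lTensor_counit_comul a x := by
    rw [cast_unop]
    exact (TensorProduct.rid_lTensor_comm _ _).trans (C.rTensor_counit_comul a.unop x)
  rTensor_counit_comul a x := by
    rw [cast_unop]
    exact (TensorProduct.lid_rTensor_comm _ _).trans (C.lTensor_counit_comul a.unop x)
  mul_antipode_rTensor_comul a x := by
    have e₁ : a.unop * a.unop⁻¹ = 1 := mul_inv_cancel _
    have e₂ : a.unop⁻¹ * a.unop = 1 := inv_mul_cancel _
    have hS : (AlgEquiv.cast (R := k) (A := fun a : Gᵐᵒᵖ => H a.unop) (inv_inv a)).toLinearMap ∘ₗ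
        g.antipodeInv (mul_inv_cancel a⁻¹.unop) = g.antipodeInv e₂ := by
      ext y
      exact (cast_unop (inv_inv a) _).trans (g.cast_antipodeInv _ _ _ y)
    rw [cast_unop, hS]
    have := g.mul_antipodeInv_comm e₁ e₂ (AlgEquiv.cast (R := k) (A := H) e₁ x)
    rw [show C.comulOf e₁ (AlgEquiv.cast (R := k) (A := H) e₁ x) = C.comul _ _ x from
      congrArg (C.comul _ _) ((AlgEquiv.cast (R := k) (A := H) e₁).symm_apply_apply x)] at this
    exact this
  mul_antipode_lTensor_comul a x := by
    have e₁ : a.unop * a.unop⁻¹ = 1 := mul_inv_cancel _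
    have e₂ : a.unop⁻¹ * a.unop = 1 := inv_mul_cancel _
    have hS : (AlgEquiv.cast (R := k) (A := fun a : Gᵐᵒᵖ => H a.unop) (inv_inv a)).toLinearMap ∘ₗ
        g.antipodeInv (mul_inv_cancel a⁻¹.unop) = g.antipodeInv e₂ := by
      ext y
      exact (cast_unop (inv_inv a) _).trans (g.cast_antipodeInv _ _ _ y)
    rw [cast_unop, hS]
    have := g.mul_antipodeInv_comm' e₂ (AlgEquiv.cast (R := k) (A := H) e₂ x)
    rw [show C.comulOf e₂ (AlgEquiv.cast (R := k) (A := H) e₂ x) = C.comul _ _ x from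
      congrArg (C.comul _ _) ((AlgEquiv.cast (R := k) (A := H) e₂).symm_apply_apply x)] at this
    exact this

/-- The inverses of a pivot form a pivot of the co-opposite. -/
noncomputable def coopPivot (g : C.Pivot) : g.coop.Pivot where
  toFun a := (g.toFun a.unop)⁻¹
  comul_apply a b := by
    refine (congrArg (TensorProduct.comm k (H b.unop) (H a.unop))
      (g.comulOf_inv_apply (rfl : b.unop * a.unop = b.unop * a.unop))).trans ?_
    simp
  counit_apply := g.counit_inv_apply
  antipode_antipode a x := by
    have e₁ : a.unop * a.unop⁻¹ = 1 := mul_inv_cancel _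
    have e₂ : a.unop⁻¹ * a.unop = 1 := inv_mul_cancel _
    -- It suffices to compare the images under `S²`, where both inverse antipodes cancel.
    refine ((cast_unop (inv_inv a) _).trans (g.cast_antipodeInv _ e₂ _ _)).trans ?_
    apply (g.antipodeOf_bijective e₁).1
    rw [g.antipodeOf_antipodeInv e₂ e₁]
    apply (g.antipodeOf_bijective e₂).1
    refine (g.antipodeOf_antipodeInv e₁ e₂ x).trans ?_
    rw [g.antipodeOf_antipodeOf]
    simp [mul_assoc]

/-- The degree-one algebra and the counit are unchanged. -/
theorem isUnimodular_coop (g : C.Pivot) (hC : C.IsUnimodular) : g.coop.IsUnimodular := hC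

theorem isRightIntegral_coop_iff (g : C.Pivot) (μ : ∀ α, Module.Dual k (H α)) :
    g.coop.IsRightIntegral (fun a : Gᵐᵒᵖ => μ a.unop) ↔ C.IsLeftIntegral μ := by
  have key (α β : G) (x : H (α * β)) : TensorProduct.lid k (H α) ((μ β).rTensor (H α)
      (g.coop.comul (op β) (op α) x)) = TensorProduct.rid k (H α) ((μ β).lTensor (H α)
        (C.comul α β x)) := TensorProduct.lid_rTensor_comm (μ β) (C.comul α β x)
  exact ⟨fun h α β x => (key α β x).symm.trans (h (op β) (op α) x),
    fun h a b x => (key b.unop a.unop x).trans (h b.unop a.unop x)⟩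

/-- Both sides are the trace of `v ↦ g⁻¹ v f(1)`. -/
theorem leftTrace_eq_rightTrace_coop [∀ α, FiniteDimensional k (H α)] (g : C.Pivot) (α : G)
    (f : Module.End (H α) (H α)) :
    g.leftTrace α (H α) f = g.coopPivot.rightTrace (op α) (H (op α).unop) f := by
  rw [g.leftTrace_eq_trace]
  exact (g.coopPivot.rightTrace_eq_regTrace (op α) f).symm

end Pivot
end HopfGCoalgebra

theorem mainTheorem5 {k : Type u} {G : Type w} {H : G → Type v} [Field k] [Group G]
    [∀ α, Ring (H α)] [∀ α, Algebra k (H α)] [∀ α, FiniteDimensional k (H α)]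
    (C : HopfGCoalgebra k H) (hC : C.IsUnimodular) (g : C.Pivot) :
    -- non-vanishing of the traces on `H_α` (nonzero algebra) and semisimplicity
    (∀ α : G, Nontrivial (H α) →
      ((g.rightTrace α (H α) ≠ 0 ↔ ∀ β : G, IsSemisimpleMod k (H β)) ∧
        (g.leftTrace α (H α) ≠ 0 ↔ ∀ β : G, IsSemisimpleMod k (H β)))) ∧
    -- semisimplicity in all degrees is semisimplicity in degree one
    ((∀ β : G, IsSemisimpleMod k (H β)) ↔ IsSemisimpleMod k (H 1)) ∧
    -- in the semisimple case the traces are given by the symmetrised integrals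
    ((∀ β : G, IsSemisimpleMod k (H β)) →
      ((∃ μ : ∀ α, Module.Dual k (H α), C.IsRightIntegral μ ∧ μ ≠ 0) ∧
        ∀ μ : ∀ α, Module.Dual k (H α), C.IsRightIntegral μ → μ ≠ 0 →
          ∃ c : k, c ≠ 0 ∧ ∀ (α : G) (f : Module.End (H α) (H α)),
            g.rightTrace α (H α) f = c * g.symRight μ α (f 1)) ∧
      ((∃ μ : ∀ α, Module.Dual k (H α), C.IsLeftIntegral μ ∧ μ ≠ 0) ∧
        ∀ μ : ∀ α, Module.Dual k (H α), C.IsLeftIntegral μ → μ ≠ 0 →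
          ∃ c : k, c ≠ 0 ∧ ∀ (α : G) (f : Module.End (H α) (H α)),
            g.leftTrace α (H α) f = c * g.symLeft μ α (f 1))) := by
  have hC' := g.isUnimodular_coop hC
  refine ⟨fun α _ => ⟨g.rightTrace_ne_zero_iff hC α, ?_⟩, hC.isSemisimpleMod_iff g, fun hH => ?_⟩
  · have : g.leftTrace α (H α) =
        g.coopPivot.rightTrace (MulOpposite.op α) (H (MulOpposite.op α).unop) :=
      funext (g.leftTrace_eq_rightTrace_coop α)
    rw [this]
    have hα : Nontrivial (H (MulOpposite.op α).unop) := ‹Nontrivial (H α)›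
    exact (g.coopPivot.rightTrace_ne_zero_iff hC' (MulOpposite.op α)).trans
      ⟨fun h β => h (MulOpposite.op β), fun h b => h b.unop⟩
  · obtain ⟨⟨μ, hμ, hμ0⟩, hleft⟩ := g.coopPivot.rightTrace_eq_integral hC' (hH 1)
    refine ⟨g.rightTrace_eq_integral hC (hH 1),
      ⟨fun α => μ (MulOpposite.op α), (g.isRightIntegral_coop_iff _).mp hμ,
        fun h => hμ0 (funext fun a => congrFun h a.unop)⟩, fun ν hν hν0 => ?_⟩
    obtain ⟨c, hc, hν'⟩ := hleft (fun a => ν a.unop) ((g.isRightIntegral_coop_iff ν).mpr hν)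
      fun h => hν0 (funext fun α => congrFun h (MulOpposite.op α))
    exact ⟨c, hc, fun α f =>
      (g.leftTrace_eq_rightTrace_coop α f).trans (hν' (MulOpposite.op α) f)⟩
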